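/- Let $s\ge 2$, $c\ge 0$, and let $X$ be a smooth manifold of dimension $2(s+1)+c$ with a pointwise $s$-Kähler structure of rank two: a Riemannian metric $\mathbf g$ and smooth two-forms $\omega_{jk}$, $j,k\in\{0,\dots,s\}$, such that at every point there is an orthonormal basis $v_{ij}$ ($i=1,2$, $j=0,\dots,s$), $u_1,\dots,u_c$ of the cotangent space (an adapted coframe) with $\omega_{jk}=v_{1j}\wedge v_{1k}+v_{2j}\wedge v_{2k}$ for all $j,k$. (In particular $X$ can be any almost $s$-Kähler manifold of rank two.) Fix $p\in X$ and an adapted coframe at $p$. On $\bigwedge^*T_p^*X$ consider the operators $$L_{jk}=\omega_{jk}\wedge\cdot\ (j\ne k),\qquad V_j=v_{1j}\wedge v_{2j}\wedge\cdot,\qquad \Lambda_{jk}=L_{jk}^*,\qquad A_j=V_j^*,$$ where $*$ is the adjoint with respect to the metric induced by $\mathbf g$. Let $\mathit{Lef}^s_p$ and $\mathcal L^s_{\mathbb R,p}$ be the real Lie algebras of operators on $\bigwedge^*T_p^*X$ generated by $\{L_{jk},\Lambda_{jk}\}$ and by $\{L_{jk},V_j,\Lambda_{jk},A_j\}$ respectively,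 and let $\mathbf s\mathcal L^s_p$ be the real Lie algebra of operators on $\bigwedge^*T_p^*X\otimes\mathbb C$ generated by $\{L_{jk},\mathrm i V_j,\Lambda_{jk},\mathrm i A_j\}$; all brackets are commutators. Then $\mathit{Lef}^s_p\cong\mathbf{so}(s+1,s+1)$ as real Lie algebras, and, when real operators are identified with their complex linear extensions to $\bigwedge^*T_p^*X\otimes\mathbb C$, $$\mathit{Lef}^s_p=\mathcal L^s_{\mathbb R,p}\cap\mathbf s\mathcal L^s_p .$$ -/

import Mathlib

open scoped Manifold ContDiff TensorProduct

-- The bracket of operators and of matrices is the commutator.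
attribute [local instance 100] LieRing.ofAssociativeRing

noncomputable section

namespace SKahler

/-! ### The metric on the algebra of forms -/

section Exterior

variable {V : Type*} [AddCommGroup V] [Module ℝ V]

/-- Contraction `I_v` of a form with the vector that the bilinear form `g` associates to the
covector `v`; it is the antiderivation of the exterior algebra with `I_v w = g v w`. -/
def contract (g : LinearMap.BilinForm ℝ V) :
    V →ₗ[ℝ] Module.End ℝ (ExteriorAlgebra ℝ V) :=
  (CliffordAlgebra.contractLeft (Q := (0 : QuadraticForm ℝ V))).comp g

/-- The extension of `v ↦ I_v` to products:
`a₁ ∧ ⋯ ∧ aₙ` is sent to the operator `I_{aₙ} ∘ ⋯ ∘ I_{a₁}`. -/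
def multiContract (g : LinearMap.BilinForm ℝ V) :
    ExteriorAlgebra ℝ V →ₐ[ℝ] (Module.End ℝ (ExteriorAlgebra ℝ V))ᵐᵒᵖ :=
  ExteriorAlgebra.lift ℝ
    ⟨(MulOpposite.opLinearEquiv ℝ).toLinearMap.comp (contract g), fun v => by
      have h : contract g v * contract g v = 0 := by
        refine LinearMap.ext fun x => ?_
        exact CliffordAlgebra.contractLeft_contractLeft (Q := 0) (g v) x
      simp [← MulOpposite.op_mul, h]⟩

/-- The bilinear form induced by `g` on the whole exterior algebra: homogeneous components of
different degree are orthogonal, and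
`⟨a₁ ∧ ⋯ ∧ aₙ, b₁ ∧ ⋯ ∧ bₙ⟩ = det (g aᵢ bⱼ)`; see `formInner_ιMulti` and
`formInner_ιMulti_of_ne`. -/
def formInner (g : LinearMap.BilinForm ℝ V) : LinearMap.BilinForm ℝ (ExteriorAlgebra ℝ V) :=
  LinearMap.mk₂ ℝ
    (fun x y => ExteriorAlgebra.algebraMapInv ((multiContract g x).unop y))
    (by intros; simp) (by intros; simp) (by intros; simp) (by intros; simp)

theorem formInner_one (g : LinearMap.BilinForm ℝ V) (y : ExteriorAlgebra ℝ V) :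
    formInner g 1 y = ExteriorAlgebra.algebraMapInv y := by
  simp [formInner]

/-- Wedging with `v` and contracting with `v` are adjoint to each other. -/
theorem formInner_ι_mul (g : LinearMap.BilinForm ℝ V) (v : V) (x y : ExteriorAlgebra ℝ V) :
    formInner g (ExteriorAlgebra.ι ℝ v * x) y = formInner g x (contract g v y) := by
  simp [formInner, multiContract]

theorem contract_ιMulti (g : LinearMap.BilinForm ℝ V) (v : V) (n : ℕ) (b : Fin (n + 1) → V) :
    contract g v (ExteriorAlgebra.ιMulti ℝ (n + 1) b) =
      ∑ i : Fin (n + 1), ((-1) ^ (i : ℕ) * g v (b i)) •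
        ExteriorAlgebra.ιMulti ℝ n (fun k => b (i.succAbove k)) := by
  induction n with
  | zero =>
    have : contract g v (ExteriorAlgebra.ι ℝ (b 0)) = algebraMap ℝ _ (g v (b 0)) :=
      CliffordAlgebra.contractLeft_ι _ _ _
    simp [ExteriorAlgebra.ιMulti_succ_apply, this, Algebra.algebraMap_eq_smul_one]
  | succ n ih =>
    have h : ∀ x, contract g v (ExteriorAlgebra.ι ℝ (b 0) * x) =
        g v (b 0) • x - ExteriorAlgebra.ι ℝ (b 0) * contract g v x :=
      fun x => CliffordAlgebra.contractLeft_ι_mul _ _ _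
    rw [ExteriorAlgebra.ιMulti_succ_apply, h, ih, Finset.mul_sum,
      sub_eq_add_neg, ← Finset.sum_neg_distrib, Fin.sum_univ_succ (n := n + 1)]
    congr 1
    · simp [Matrix.vecTail, Function.comp_def]
    · refine Finset.sum_congr rfl fun i _ => ?_
      rw [ExteriorAlgebra.ιMulti_succ_apply]
      simp [Matrix.vecTail, Function.comp_def, pow_succ]

theorem algebraMapInv_ιMulti (n : ℕ) (b : Fin (n + 1) → V) :
    ExteriorAlgebra.algebraMapInv (ExteriorAlgebra.ιMulti ℝ (n + 1) b) = 0 := by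
  rw [ExteriorAlgebra.ιMulti_succ_apply]
  simp [ExteriorAlgebra.algebraMapInv]

theorem formInner_ιMulti (g : LinearMap.BilinForm ℝ V) (n : ℕ) (a b : Fin n → V) :
    formInner g (ExteriorAlgebra.ιMulti ℝ n a) (ExteriorAlgebra.ιMulti ℝ n b) =
      Matrix.det (Matrix.of fun i j => g (a i) (b j)) := by
  induction n with
  | zero => simp [formInner_one]
  | succ n ih =>
    rw [ExteriorAlgebra.ιMulti_succ_apply, formInner_ι_mul, contract_ιMulti, map_sum,
      Matrix.det_succ_row_zero]
    refine Finset.sum_congr rfl fun i _ => ?_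
    rw [map_smul, ih]
    rfl

theorem formInner_ιMulti_of_ne (g : LinearMap.BilinForm ℝ V) (m n : ℕ) (h : m ≠ n)
    (a : Fin m → V) (b : Fin n → V) :
    formInner g (ExteriorAlgebra.ιMulti ℝ m a) (ExteriorAlgebra.ιMulti ℝ n b) = 0 := by
  induction m generalizing n with
  | zero =>
    obtain _ | n := n
    · exact absurd rfl h
    · rw [ExteriorAlgebra.ιMulti_zero_apply, formInner_one, algebraMapInv_ιMulti]
  | succ m ih =>
    rw [ExteriorAlgebra.ιMulti_succ_apply, formInner_ι_mul]
    obtain _ | n := n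
    · have : contract g (a 0) 1 = 0 := CliffordAlgebra.contractLeft_one _ _
      simp [this]
    · rw [contract_ιMulti, map_sum]
      refine Finset.sum_eq_zero fun i _ => ?_
      rw [map_smul, ih n (by omega), smul_zero]

/-- `D'` is the adjoint `D*` of the operator `D` with respect to the metric induced by `g` on
the exterior algebra. -/
def IsAdjoint (g : LinearMap.BilinForm ℝ V) (D D' : Module.End ℝ (ExteriorAlgebra ℝ V)) : Prop :=
  ∀ x y, formInner g (D x) y = formInner g x (D' y)

/-- The operator `x ∧ ·` on forms. -/
def wedge (x : ExteriorAlgebra ℝ V) : Module.End ℝ (ExteriorAlgebra ℝ V) :=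
  LinearMap.mulLeft ℝ x

/-- The complex linear extension of real operators on forms to operators on complex forms, as a
morphism of real Lie algebras (the brackets are the commutators). -/
def complexify :
    Module.End ℝ (ExteriorAlgebra ℝ V) →ₗ⁅ℝ⁆ Module.End ℂ (ℂ ⊗[ℝ] ExteriorAlgebra ℝ V) where
  toFun D := LinearMap.baseChange ℂ D
  map_add' D D' := LinearMap.baseChange_add D D'
  map_smul' t D := LinearMap.baseChange_smul t D
  map_lie' {D D'} := by
    simp only [Ring.lie_def, LinearMap.baseChange_sub, Module.End.mul_eq_comp,
      LinearMap.baseChange_comp]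

end Exterior

/-! ### Cotangent spaces and two-forms -/

section Cotangent

variable {T : Type*} [AddCommGroup T] [Module ℝ T] [Module.Finite ℝ T]

/-- The isomorphism `T ≃ T*` given by a positive definite form. -/
def flat (G : LinearMap.BilinForm ℝ T) (hG : ∀ x, x ≠ 0 → 0 < G x x) :
    T ≃ₗ[ℝ] Module.Dual ℝ T :=
  LinearMap.linearEquivOfInjective G
    (by
      refine (injective_iff_map_eq_zero G).2 fun x hx => ?_
      by_contra h
      have := hG x h
      simp [hx] at this)
    Subspace.dual_finrank_eq.symm

/-- The metric induced on the dual space by a metric. -/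
def dualMetric (G : LinearMap.BilinForm ℝ T) (hG : ∀ x, x ≠ 0 → 0 < G x x) :
    LinearMap.BilinForm ℝ (Module.Dual ℝ T) :=
  G.compl₁₂ (flat G hG).symm.toLinearMap (flat G hG).symm.toLinearMap

/-- An alternating bilinear form on `T` as an element of degree two of the exterior algebra
of `T*`, with the convention `(φ ∧ ψ)(x, y) = φ(x) ψ(y) - φ(y) ψ(x)`; see `ofBilin_eq`. -/
def ofBilin (w : LinearMap.BilinForm ℝ T) : ExteriorAlgebra ℝ (Module.Dual ℝ T) :=
  (1 / 2 : ℝ) • ∑ a, ∑ b,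
    w (Module.finBasis ℝ T a) (Module.finBasis ℝ T b) •
      (ExteriorAlgebra.ι ℝ ((Module.finBasis ℝ T).coord a) *
        ExteriorAlgebra.ι ℝ ((Module.finBasis ℝ T).coord b))

theorem ofBilin_eq {κ : Type*} (S : Finset κ) (φ ψ : κ → Module.Dual ℝ T)
    (w : LinearMap.BilinForm ℝ T)
    (h : ∀ x y, w x y = ∑ i ∈ S, (φ i x * ψ i y - φ i y * ψ i x)) :
    ofBilin w = ∑ i ∈ S, ExteriorAlgebra.ι ℝ (φ i) * ExteriorAlgebra.ι ℝ (ψ i) := by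
  have key : ∀ φ : Module.Dual ℝ T, ExteriorAlgebra.ι ℝ φ =
      ∑ a, φ (Module.finBasis ℝ T a) • ExteriorAlgebra.ι ℝ ((Module.finBasis ℝ T).coord a) := by
    intro φ
    have := congrArg (ExteriorAlgebra.ι ℝ)
      ((Module.finBasis ℝ T).sum_dual_apply_smul_coord φ)
    rw [← this, map_sum]
    simp only [map_smul]
  have prod : ∀ φ ψ : Module.Dual ℝ T, ExteriorAlgebra.ι ℝ φ * ExteriorAlgebra.ι ℝ ψ =
      ∑ a, ∑ b, (φ (Module.finBasis ℝ T a) * ψ (Module.finBasis ℝ T b)) •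
        (ExteriorAlgebra.ι ℝ ((Module.finBasis ℝ T).coord a) *
          ExteriorAlgebra.ι ℝ ((Module.finBasis ℝ T).coord b)) := by
    intro φ ψ
    rw [key φ, key ψ, Finset.sum_mul_sum]
    simp only [smul_mul_smul_comm]
  have anti : ∀ φ ψ : Module.Dual ℝ T, ExteriorAlgebra.ι ℝ ψ * ExteriorAlgebra.ι ℝ φ =
      -(ExteriorAlgebra.ι ℝ φ * ExteriorAlgebra.ι ℝ ψ) := fun φ ψ =>
    eq_neg_of_add_eq_zero_left (ExteriorAlgebra.ι_add_mul_swap ψ φ)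
  have two : ∀ i, ExteriorAlgebra.ι ℝ (φ i) * ExteriorAlgebra.ι ℝ (ψ i) =
      (1 / 2 : ℝ) • (ExteriorAlgebra.ι ℝ (φ i) * ExteriorAlgebra.ι ℝ (ψ i) -
        ExteriorAlgebra.ι ℝ (ψ i) * ExteriorAlgebra.ι ℝ (φ i)) := by
    intro i
    rw [anti (φ i) (ψ i), sub_neg_eq_add, ← two_smul ℝ, smul_smul]
    norm_num
  rw [Finset.sum_congr rfl fun i _ => two i, ← Finset.smul_sum, ofBilin]
  congr 1
  simp only [h, Finset.sum_smul, sub_smul, Finset.sum_sub_distrib]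
  rw [Finset.sum_congr rfl fun i _ => prod (φ i) (ψ i),
    Finset.sum_congr rfl fun i _ => prod (ψ i) (φ i)]
  congr 1
  · symm
    rw [Finset.sum_comm]
    exact Finset.sum_congr rfl fun a _ => Finset.sum_comm
  · symm
    rw [Finset.sum_comm]
    refine Finset.sum_congr rfl fun a _ => ?_
    rw [Finset.sum_comm]
    exact Finset.sum_congr rfl fun b _ => Finset.sum_congr rfl fun i _ => by rw [mul_comm (ψ i _)]

/-- An adapted coframe of rank `r`: an orthonormal basis `v_{ij}`, `u_1, …, u_c` of the cotangent
space with `ω_{jk} = ∑ i, v_{ij} ∧ v_{ik}`.  It is used for `dim T = (s + 1) * r + c`, so that the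
orthonormal family below is a basis. -/
structure AdaptedCoframe (s r c : ℕ) (G : LinearMap.BilinForm ℝ T)
    (hG : ∀ x, x ≠ 0 → 0 < G x x) (w : Fin (s + 1) → Fin (s + 1) → LinearMap.BilinForm ℝ T) where
  /-- the covectors `v_{ij}` -/
  v : Fin r → Fin (s + 1) → Module.Dual ℝ T
  /-- the covectors `u_l` -/
  u : Fin c → Module.Dual ℝ T
  orthonormal : ∀ a b : (Fin r × Fin (s + 1)) ⊕ Fin c,
    dualMetric G hG (Sum.elim (fun i => v i.1 i.2) u a) (Sum.elim (fun i => v i.1 i.2) u b) =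
      if a = b then 1 else 0
  form_eq : ∀ j k x y, w j k x y = ∑ i, (v i j x * v i k y - v i j y * v i k x)

end Cotangent

/-! ### Pointwise `s`-Kähler manifolds -/

/-- A smooth differential two-form on a manifold. -/
structure TwoForm (n : ℕ) (X : Type*) [TopologicalSpace X]
    [ChartedSpace (EuclideanSpace ℝ (Fin n)) X] [IsManifold (𝓡 n) ∞ X] where
  /-- the value of the form at a point -/
  toFun (p : X) : TangentSpace (𝓡 n) p →L[ℝ] TangentSpace (𝓡 n) p →L[ℝ] ℝ
  alt (p : X) (x : TangentSpace (𝓡 n) p) : toFun p x x = 0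
  contMDiff : ContMDiff (𝓡 n)
    ((𝓡 n).prod 𝓘(ℝ, EuclideanSpace ℝ (Fin n) →L[ℝ] EuclideanSpace ℝ (Fin n) →L[ℝ] ℝ)) ∞
    (fun p => Bundle.TotalSpace.mk'
      (EuclideanSpace ℝ (Fin n) →L[ℝ] EuclideanSpace ℝ (Fin n) →L[ℝ] ℝ) p (toFun p))

instance {n : ℕ} {X : Type*} [TopologicalSpace X]
    [ChartedSpace (EuclideanSpace ℝ (Fin n)) X] (p : X) :
    Module.Finite ℝ (TangentSpace (𝓡 n) p) :=
  inferInstanceAs (Module.Finite ℝ (EuclideanSpace ℝ (Fin n)))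

/-- A continuous bilinear form, as a bilinear form. -/
def toBilin {T : Type*} [AddCommGroup T] [Module ℝ T] [TopologicalSpace T]
    (B : T →L[ℝ] T →L[ℝ] ℝ) : LinearMap.BilinForm ℝ T :=
  LinearMap.mk₂ ℝ (fun x y => B x y) (by simp) (by simp) (by simp) (by simp)

/-- A pointwise `s`-Kähler structure of rank `r` on a smooth manifold of dimension
`(s + 1) * r + c`: a Riemannian metric and smooth two-forms `ω_{jk}`, `0 ≤ j, k ≤ s`, that admit an
adapted coframe at every point.  (An almost `s`-Kähler structure is such a structure for which
moreover `ω_{01}, …, ω_{0s}` have simultaneous Darboux coordinates.) -/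
structure PointwiseSKahler (s r c : ℕ) (X : Type*) [TopologicalSpace X]
    [ChartedSpace (EuclideanSpace ℝ (Fin ((s + 1) * r + c))) X]
    [IsManifold (𝓡 ((s + 1) * r + c)) ∞ X] where
  metric : Bundle.ContMDiffRiemannianMetric (𝓡 ((s + 1) * r + c)) ∞
    (EuclideanSpace ℝ (Fin ((s + 1) * r + c)))
    (fun p : X => TangentSpace (𝓡 ((s + 1) * r + c)) p)
  form : Fin (s + 1) → Fin (s + 1) → TwoForm ((s + 1) * r + c) X
  exists_coframe : ∀ p : X, Nonempty (AdaptedCoframe s r c (toBilin (metric.inner p))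
    (metric.pos p) (fun j k => toBilin ((form j k).toFun p)))

namespace PointwiseSKahler

variable {s r c : ℕ} {X : Type*} [TopologicalSpace X]
  [ChartedSpace (EuclideanSpace ℝ (Fin ((s + 1) * r + c))) X]
  [IsManifold (𝓡 ((s + 1) * r + c)) ∞ X]

/-- The algebra `⋀* T*_p X` of real forms at `p`. -/
abbrev Forms (_K : PointwiseSKahler s r c X) (p : X) : Type :=
  ExteriorAlgebra ℝ (Module.Dual ℝ (TangentSpace (𝓡 ((s + 1) * r + c)) p))

/-- The adapted coframes at `p`.  For `r = 2` every such coframe gives a determination of the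
complex structure `J` at `p`, that is, compatible orientations of the planes
`W_j = ⟨v_{1j}, v_{2j}⟩`. -/
abbrev Coframe (K : PointwiseSKahler s r c X) (p : X) : Type :=
  AdaptedCoframe s r c (toBilin (K.metric.inner p)) (K.metric.pos p)
    (fun j k => toBilin ((K.form j k).toFun p))

/-- The metric on `T*_p X`. -/
def cometric (K : PointwiseSKahler s r c X) (p : X) :
    LinearMap.BilinForm ℝ (Module.Dual ℝ (TangentSpace (𝓡 ((s + 1) * r + c)) p)) :=
  dualMetric (toBilin (K.metric.inner p)) (K.metric.pos p)

/-- The operator `L_{jk}` at `p`, the wedge product with `ω_{jk}`. -/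
def L (K : PointwiseSKahler s r c X) (p : X) (j k : Fin (s + 1)) : Module.End ℝ (K.Forms p) :=
  wedge (ofBilin (toBilin ((K.form j k).toFun p)))

/-- The operators `L_{jk}` and `Λ_{jk} = L_{jk}*`, `j ≠ k`. -/
def lefGenerators (K : PointwiseSKahler s r c X) (p : X) : Set (Module.End ℝ (K.Forms p)) :=
  {D | ∃ j k, j ≠ k ∧ (D = K.L p j k ∨ IsAdjoint (K.cometric p) (K.L p j k) D)}

/-- The fibre at `p` of the Lefschetz bundle. -/
def lef (K : PointwiseSKahler s r c X) (p : X) : LieSubalgebra ℝ (Module.End ℝ (K.Forms p)) :=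
  LieSubalgebra.lieSpan ℝ _ (K.lefGenerators p)

end PointwiseSKahler

namespace PointwiseSKahler

variable {s c : ℕ} {X : Type*} [TopologicalSpace X]
  [ChartedSpace (EuclideanSpace ℝ (Fin ((s + 1) * 2 + c))) X]
  [IsManifold (𝓡 ((s + 1) * 2 + c)) ∞ X]

/-- The operator `V_j` at `p`, the wedge product with the volume form `v_{1j} ∧ v_{2j}` of `W_j`,
in the orientation given by the coframe. -/
def V (K : PointwiseSKahler s 2 c X) {p : X} (F : K.Coframe p) (j : Fin (s + 1)) :
    Module.End ℝ (K.Forms p) :=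
  wedge (ExteriorAlgebra.ι ℝ (F.v 0 j) * ExteriorAlgebra.ι ℝ (F.v 1 j))

/-- The operators `V_j` and `A_j = V_j*`. -/
def volGenerators (K : PointwiseSKahler s 2 c X) {p : X} (F : K.Coframe p) :
    Set (Module.End ℝ (K.Forms p)) :=
  {D | ∃ j, D = K.V F j ∨ IsAdjoint (K.cometric p) (K.V F j) D}

/-- The fibre at `p` of the real Lie algebra bundle generated by
`L_{jk}`, `V_j`, `Λ_{jk}`, `A_j`. -/
def algR (K : PointwiseSKahler s 2 c X) {p : X} (F : K.Coframe p) :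
    LieSubalgebra ℝ (Module.End ℝ (K.Forms p)) :=
  LieSubalgebra.lieSpan ℝ _ (K.lefGenerators p ∪ K.volGenerators F)

/-- The fibre at `p` of the real Lie algebra bundle of operators on complex forms generated by
`L_{jk}`, `i V_j`, `Λ_{jk}`, `i A_j`. -/
def algS (K : PointwiseSKahler s 2 c X) {p : X} (F : K.Coframe p) :
    LieSubalgebra ℝ (Module.End ℂ (ℂ ⊗[ℝ] K.Forms p)) :=
  LieSubalgebra.lieSpan ℝ _
    (complexify '' K.lefGenerators p ∪
      (fun D => Complex.I • complexify D) '' K.volGenerators F)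

end PointwiseSKahler

end SKahler

end

/-! Multiplications by the covectors v_{ij} and contractions with them satisfy the Clifford
relations of the form 1 ⊗ `JD`, where `JD` is the split form on the index j. Quadratic expressions
with skew coefficients are closed under commutators (`lie_quad`), so the coefficients 1 ⊗ (M · `JD`)
give a representation `spin` of the orthogonal algebra `typeD`, faithful because the bracket with
the Clifford generators determines the coefficients. The operators L_{jk} and Λ_{jk} are the images
of the elementary off-diagonal blocks, and with at least three indices these generate `typeD`
(`typeD_le`). Hence the Lefschetz algebra R is the image of `spin` (`lef_eq`), a copy of so(s+1,
s+1).

The operators V_j and A_j have coefficients `rot` ⊗ (N · `JD`) with N self-adjoint for `JD`; such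
expressions form a space P = `spinCompl`. Then [R, P] ⊆ P, and [P, P] ⊆ R because `rot` squares to
-1. So R + iP is a real Lie algebra (`twist`), and it contains the generators of `algS`. A real
operator in R + iP has zero imaginary part, hence lies in R. The reverse inclusion is visible on
generators. -/

noncomputable section

namespace SKahler

/-! ### Quadratic expressions in generators of a Clifford algebra -/

section Quadratic

variable {κ A : Type*} [Fintype κ] [Ring A] [Algebra ℝ A]

/-- The quadratic expression `½ ∑ B_{ab} φ_a φ_b`. -/
def quad (φ : κ → A) : Matrix κ κ ℝ →ₗ[ℝ] A where
  toFun B := (1 / 2 : ℝ) • ∑ a, ∑ b, B a b • (φ a * φ b)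
  map_add' B B' := by simp [add_smul, Finset.sum_add_distrib]
  map_smul' t B := by
    simp only [Matrix.smul_apply, smul_eq_mul, mul_smul, ← Finset.smul_sum, RingHom.id_apply]
    rw [smul_comm]

theorem quad_apply (φ : κ → A) (B : Matrix κ κ ℝ) :
    quad φ B = (1 / 2 : ℝ) • ∑ a, ∑ b, B a b • (φ a * φ b) := rfl

/-- The bracket with a quadratic expression acts linearly on the span of the generators. Moving φ_c
past φ_a φ_b leaves two anticommutators; skewness of B makes their sums equal, which cancels the
factor ½. -/
theorem lie_quad_generator {φ : κ → A} {S : Matrix κ κ ℝ}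
    (hφ : ∀ a b, φ a * φ b + φ b * φ a = S a b • 1) {B : Matrix κ κ ℝ}
    (hB : B.transpose = -B) (c : κ) :
    ⁅quad φ B, φ c⁆ = ∑ a, (B * S) a c • φ a := by
  have key : ∀ a b, φ a * φ b * φ c - φ c * (φ a * φ b) = S b c • φ a - S a c • φ b := by
    intro a b
    have h1 := congrArg (φ a * ·) (hφ b c)
    have h2 := congrArg (· * φ b) (hφ a c)
    simp only [mul_smul_comm, smul_mul_assoc, mul_one, one_mul] at h1 h2
    rw [← h1, ← h2]
    noncomm_ring
  have hB' : ∀ a b, B b a = -B a b := fun a b => congrFun (congrFun hB a) b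
  have h : ⁅quad φ B, φ c⁆ =
      (1 / 2 : ℝ) • ∑ a, ∑ b, B a b • (S b c • φ a - S a c • φ b) := by
    simp only [Ring.lie_def, quad_apply, smul_mul_assoc, mul_smul_comm, Finset.sum_mul,
      Finset.mul_sum, ← smul_sub, ← Finset.sum_sub_distrib, key]
  have h2 : ∑ a, ∑ b, B a b • (S a c • φ b) = -∑ a, ∑ b, B a b • (S b c • φ a) := by
    rw [Finset.sum_comm, ← Finset.sum_neg_distrib]
    refine Finset.sum_congr rfl fun a _ => ?_
    rw [← Finset.sum_neg_distrib]
    refine Finset.sum_congr rfl fun b _ => ?_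
    rw [hB' a b, neg_smul]
  rw [h]
  have h3 : ∑ a, ∑ b, B a b • (S b c • φ a - S a c • φ b) =
      (2 : ℝ) • ∑ a, ∑ b, B a b • (S b c • φ a) := by
    rw [two_smul, ← sub_neg_eq_add, ← h2]
    simp only [smul_sub, Finset.sum_sub_distrib]
  rw [h3, smul_smul, one_div_mul_cancel two_ne_zero, one_smul]
  simp only [Matrix.mul_apply, Finset.sum_smul, mul_smul]

/-- The bracket is a derivation, so `lie_quad_generator` applies to each factor of φ_c φ_d. The
second factor yields B'(BS)ᵀ, which is -B'SB by the symmetries of B and S. -/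
theorem lie_quad {φ : κ → A} {S : Matrix κ κ ℝ}
    (hφ : ∀ a b, φ a * φ b + φ b * φ a = S a b • 1) (hS : S.transpose = S)
    {B : Matrix κ κ ℝ} (hB : B.transpose = -B) (B' : Matrix κ κ ℝ) :
    ⁅quad φ B, quad φ B'⁆ = quad φ (B * S * B' - B' * S * B) := by
  have leib : ∀ x y z : A, ⁅x, y * z⁆ = ⁅x, y⁆ * z + y * ⁅x, z⁆ := by
    intro x y z
    simp only [Ring.lie_def]
    noncomm_ring
  have h0 : ⁅quad φ B, quad φ B'⁆ =
      (1 / 2 : ℝ) • ∑ c, ∑ d, B' c d • ⁅quad φ B, φ c * φ d⁆ := by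
    rw [quad_apply φ B', lie_smul]
    simp only [Ring.lie_def, Finset.mul_sum, Finset.sum_mul, mul_smul_comm, smul_mul_assoc,
      smul_sub, Finset.sum_sub_distrib]
  have h1 : ∑ c, ∑ d, B' c d • ((∑ a, (B * S) a c • φ a) * φ d) =
      ∑ a, ∑ d, (B * S * B') a d • (φ a * φ d) := by
    simp only [Finset.sum_mul, smul_mul_assoc, Finset.smul_sum, smul_smul,
      Matrix.mul_apply (M := B * S), Finset.sum_smul]
    rw [Finset.sum_congr rfl fun c _ => Finset.sum_comm, Finset.sum_comm]
    refine Finset.sum_congr rfl fun a _ => ?_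
    rw [Finset.sum_comm]
    simp only [mul_comm]
  have h2 : ∑ c, ∑ d, B' c d • (φ c * ∑ a, (B * S) a d • φ a) =
      ∑ c, ∑ a, (B' * (B * S).transpose) c a • (φ c * φ a) := by
    simp only [Finset.mul_sum, mul_smul_comm, Finset.smul_sum, smul_smul,
      Matrix.mul_apply (M := B'), Matrix.transpose_apply, Finset.sum_smul]
    exact Finset.sum_congr rfl fun c _ => Finset.sum_comm
  have h3 : B * S * B' - B' * S * B = B * S * B' + B' * (B * S).transpose := by
    rw [Matrix.transpose_mul, hS, hB]
    simp [Matrix.mul_assoc, sub_eq_add_neg]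
  rw [h0, h3, map_add, quad_apply φ (B * S * B'), quad_apply φ (B' * (B * S).transpose), ← h1,
    ← h2, ← smul_add, ← Finset.sum_add_distrib]
  simp only [← Finset.sum_add_distrib, ← smul_add, leib, lie_quad_generator hφ hB]

theorem eq_zero_of_quad_eq_zero [Nontrivial A] [DecidableEq κ] {φ : κ → A} {S : Matrix κ κ ℝ}
    (hφ : ∀ a b, φ a * φ b + φ b * φ a = S a b • 1) (hS : S * S = 1)
    {B : Matrix κ κ ℝ} (hB : B.transpose = -B) (h : quad φ B = 0) : B = 0 := by
  have h1 : S * (B * S) = 0 := by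
    ext d c
    have h2 := lie_quad_generator hφ hB c
    rw [h, zero_lie] at h2
    -- Anticommuting with φ_d turns a linear relation among generators into a scalar one, so linear
    -- independence of the φ_a is not needed in advance.
    have h3 : φ d * (∑ a, (B * S) a c • φ a) + (∑ a, (B * S) a c • φ a) * φ d =
        (S * (B * S)) d c • (1 : A) := by
      simp only [Finset.mul_sum, Finset.sum_mul, mul_smul_comm, smul_mul_assoc,
        ← Finset.sum_add_distrib, ← smul_add, hφ, Matrix.mul_apply (M := S), Finset.sum_smul, smul_smul]
      simp only [mul_comm]
    rw [← h2, mul_zero, zero_mul, add_zero] at h3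
    simpa using h3.symm
  calc B = S * S * B * (S * S) := by simp [hS]
    _ = S * (S * (B * S)) * S := by simp only [Matrix.mul_assoc]
    _ = 0 := by simp [h1]

end Quadratic

/-! ### Quadratic expressions indexed by tensor products -/

section Kronecker

open scoped Kronecker
open LieAlgebra.Orthogonal (JD typeD)

theorem JD_transpose {l : Type*} [DecidableEq l] : (JD l ℝ).transpose = JD l ℝ := by
  simp [JD, Matrix.fromBlocks_transpose]

variable {l A : Type*} [Fintype l] [DecidableEq l] [Ring A] [Algebra ℝ A]

theorem JD_mul_JD : JD l ℝ * JD l ℝ = 1 := by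
  simp [JD, Matrix.fromBlocks_multiply]

theorem fromBlocks_mul_JD (B₁ B₂ B₃ B₄ : Matrix l l ℝ) :
    Matrix.fromBlocks B₁ B₂ B₃ B₄ * JD l ℝ = Matrix.fromBlocks B₂ B₁ B₄ B₃ := by
  simp [JD, Matrix.fromBlocks_multiply]

theorem mem_typeD_iff (M : Matrix (l ⊕ l) (l ⊕ l) ℝ) :
    M ∈ typeD l ℝ ↔ (M * JD l ℝ).transpose = -(M * JD l ℝ) := by
  rw [typeD, mem_skewAdjointMatricesLieSubalgebra, mem_skewAdjointMatricesSubmodule,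
    Matrix.IsSkewAdjoint, Matrix.IsAdjointPair, Matrix.transpose_mul, JD_transpose]
  constructor <;> intro h
  · calc JD l ℝ * M.transpose = JD l ℝ * (M.transpose * JD l ℝ) * JD l ℝ := by
          rw [Matrix.mul_assoc, Matrix.mul_assoc, JD_mul_JD, Matrix.mul_one]
      _ = JD l ℝ * JD l ℝ * -M * JD l ℝ := by rw [h]; simp only [Matrix.mul_assoc]
      _ = _ := by rw [JD_mul_JD]; simp
  · calc M.transpose * JD l ℝ = JD l ℝ * (JD l ℝ * M.transpose) * JD l ℝ := by
          rw [← Matrix.mul_assoc, JD_mul_JD, Matrix.one_mul]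
      _ = JD l ℝ * -M * (JD l ℝ * JD l ℝ) := by rw [h]; simp only [Matrix.mul_assoc, neg_mul, mul_neg]
      _ = _ := by rw [JD_mul_JD, Matrix.mul_one]

/-- The matrices that are self-adjoint with respect to `JD`. -/
def selfAdjD (l : Type*) [Fintype l] [DecidableEq l] : Submodule ℝ (Matrix (l ⊕ l) (l ⊕ l) ℝ) where
  carrier := {M | (M * JD l ℝ).transpose = M * JD l ℝ}
  add_mem' {M N} hM hN := by
    simp only [Set.mem_ofPred_eq] at *
    rw [Matrix.add_mul, Matrix.transpose_add, hM, hN]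
  zero_mem' := by simp
  smul_mem' t M hM := by
    simp only [Set.mem_ofPred_eq] at *
    rw [Matrix.smul_mul, Matrix.transpose_smul, hM]

theorem mem_selfAdjD (M : Matrix (l ⊕ l) (l ⊕ l) ℝ) :
    M ∈ selfAdjD l ↔ (M * JD l ℝ).transpose = M * JD l ℝ := Iff.rfl

/-- Adjunction for `JD` reverses products, so it sends a commutator of eigenvectors with eigenvalues
s, t to -st times itself. With signs ±1 this is the ℤ/2-grading by skew-adjoint and self-adjoint
matrices. -/
theorem transpose_lie_mul_JD {M N : Matrix (l ⊕ l) (l ⊕ l) ℝ} {s t : ℝ}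
    (hM : (M * JD l ℝ).transpose = s • (M * JD l ℝ))
    (hN : (N * JD l ℝ).transpose = t • (N * JD l ℝ)) :
    (⁅M, N⁆ * JD l ℝ).transpose = -(s * t) • (⁅M, N⁆ * JD l ℝ) := by
  have h : ∀ {M N : Matrix (l ⊕ l) (l ⊕ l) ℝ} {s t : ℝ},
      (M * JD l ℝ).transpose = s • (M * JD l ℝ) → (N * JD l ℝ).transpose = t • (N * JD l ℝ) →
      (M * N * JD l ℝ).transpose = (s * t) • (N * M * JD l ℝ) := by
    intro M N s t hM hN
    have e : M * N * JD l ℝ = M * JD l ℝ * (JD l ℝ * (N * JD l ℝ)) := by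
      rw [← Matrix.mul_assoc, Matrix.mul_assoc M (JD l ℝ) (JD l ℝ), JD_mul_JD, Matrix.mul_one, Matrix.mul_assoc]
    rw [e, Matrix.transpose_mul, Matrix.transpose_mul, hM, hN, JD_transpose]
    simp only [Matrix.smul_mul, Matrix.mul_smul, smul_smul]
    congr 1
    rw [Matrix.mul_assoc N, JD_mul_JD, Matrix.mul_one, ← Matrix.mul_assoc]
  rw [Ring.lie_def, Matrix.sub_mul, Matrix.transpose_sub, h hM hN, h hN hM, mul_comm t s,
    ← smul_sub, neg_smul, ← smul_neg, neg_sub]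

theorem lie_mem_selfAdjD {M N : Matrix (l ⊕ l) (l ⊕ l) ℝ} (hM : M ∈ typeD l ℝ)
    (hN : N ∈ selfAdjD l) : ⁅M, N⁆ ∈ selfAdjD l := by
  rw [mem_typeD_iff] at hM
  rw [mem_selfAdjD] at *
  simpa using transpose_lie_mul_JD (s := -1) (t := 1) (by simpa using hM) (by simpa using hN)

theorem lie_mem_typeD {M N : Matrix (l ⊕ l) (l ⊕ l) ℝ} (hM : M ∈ selfAdjD l)
    (hN : N ∈ selfAdjD l) : ⁅M, N⁆ ∈ typeD l ℝ := by
  rw [mem_selfAdjD] at *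
  rw [mem_typeD_iff]
  simpa using transpose_lie_mul_JD (s := 1) (t := 1) (by simpa using hM) (by simpa using hN)

/-- The rotation of the plane by a right angle. -/
def rot : Matrix (Fin 2) (Fin 2) ℝ := !![0, 1; -1, 0]

theorem rot_mul_rot : rot * rot = -1 := by
  ext i j; fin_cases i <;> fin_cases j <;> simp [rot]

theorem rot_transpose : rot.transpose = -rot := by
  ext i j; fin_cases i <;> fin_cases j <;> simp [rot]

/-- The quadratic expression with coefficients `K ⊗ (M * JD)`. -/
def quadTensor (φ : Fin 2 × (l ⊕ l) → A) (K : Matrix (Fin 2) (Fin 2) ℝ) :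
    Matrix (l ⊕ l) (l ⊕ l) ℝ →ₗ[ℝ] A where
  toFun M := quad φ (K ⊗ₖ (M * JD l ℝ))
  map_add' M N := by rw [Matrix.add_mul, Matrix.kronecker_add, map_add]
  map_smul' t M := by rw [Matrix.smul_mul, Matrix.kronecker_smul, map_smul, RingHom.id_apply]

theorem quadTensor_apply (φ : Fin 2 × (l ⊕ l) → A) (K : Matrix (Fin 2) (Fin 2) ℝ)
    (M : Matrix (l ⊕ l) (l ⊕ l) ℝ) : quadTensor φ K M = quad φ (K ⊗ₖ (M * JD l ℝ)) := rfl

/-- As `JD` squares to 1, multiplying K ⊗ (M · `JD`) by the Gram matrix 1 ⊗ `JD` gives K ⊗ M. The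
factor `JD` in the coefficients is there so that the matrix commutator appears. -/
theorem lie_quadTensor {φ : Fin 2 × (l ⊕ l) → A}
    (hφ : ∀ a b, φ a * φ b + φ b * φ a = ((1 : Matrix (Fin 2) (Fin 2) ℝ) ⊗ₖ JD l ℝ) a b • 1)
    {K K' : Matrix (Fin 2) (Fin 2) ℝ} (hK : K * K' = K' * K) {M : Matrix (l ⊕ l) (l ⊕ l) ℝ}
    (hM : (K ⊗ₖ (M * JD l ℝ)).transpose = -(K ⊗ₖ (M * JD l ℝ)))
    (M' : Matrix (l ⊕ l) (l ⊕ l) ℝ) :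
    ⁅quadTensor φ K M, quadTensor φ K' M'⁆ = quadTensor φ (K * K') ⁅M, M'⁆ := by
  have hS : ((1 : Matrix (Fin 2) (Fin 2) ℝ) ⊗ₖ JD l ℝ).transpose = 1 ⊗ₖ JD l ℝ := by
    rw [← Matrix.kroneckerMap_transpose, Matrix.transpose_one, JD_transpose]
  have cancel : ∀ M : Matrix (l ⊕ l) (l ⊕ l) ℝ, M * JD l ℝ * JD l ℝ = M := fun M => by
    rw [Matrix.mul_assoc, JD_mul_JD, Matrix.mul_one]
  rw [quadTensor_apply, quadTensor_apply, lie_quad hφ hS hM, quadTensor_apply]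
  simp only [← Matrix.mul_kronecker_mul, Matrix.mul_one, cancel, ← Matrix.mul_assoc]
  rw [← hK, Ring.lie_def, Matrix.sub_mul, sub_eq_add_neg (M * M' * JD l ℝ), Matrix.kronecker_add,
    sub_eq_add_neg]
  congr 2
  rw [← neg_one_smul ℝ (M' * M * JD l ℝ), Matrix.kronecker_smul, neg_one_smul]

theorem one_kronecker_transpose {M : Matrix (l ⊕ l) (l ⊕ l) ℝ} (hM : M ∈ typeD l ℝ) :
    ((1 : Matrix (Fin 2) (Fin 2) ℝ) ⊗ₖ (M * JD l ℝ)).transpose = -(1 ⊗ₖ (M * JD l ℝ)) := by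
  rw [← Matrix.kroneckerMap_transpose, Matrix.transpose_one, (mem_typeD_iff M).1 hM,
    ← neg_one_smul ℝ (M * JD l ℝ), Matrix.kronecker_smul, neg_one_smul]

theorem rot_kronecker_transpose {M : Matrix (l ⊕ l) (l ⊕ l) ℝ} (hM : M ∈ selfAdjD l) :
    (rot ⊗ₖ (M * JD l ℝ)).transpose = -(rot ⊗ₖ (M * JD l ℝ)) := by
  rw [← Matrix.kroneckerMap_transpose, rot_transpose, (mem_selfAdjD M).1 hM,
    ← neg_one_smul ℝ rot, Matrix.smul_kronecker, neg_one_smul]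

/-- The spin representation of the orthogonal algebra, on two copies of the spinors. -/
def spin (φ : Fin 2 × (l ⊕ l) → A)
    (hφ : ∀ a b, φ a * φ b + φ b * φ a = ((1 : Matrix (Fin 2) (Fin 2) ℝ) ⊗ₖ JD l ℝ) a b • 1) :
    typeD l ℝ →ₗ⁅ℝ⁆ A where
  toFun M := quadTensor φ 1 M
  map_add' M N := by simp
  map_smul' t M := by simp
  map_lie' {M N} := by
    simp [lie_quadTensor hφ rfl (one_kronecker_transpose M.2)]

theorem spin_injective [Nontrivial A] {φ : Fin 2 × (l ⊕ l) → A} (hφ) :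
    Function.Injective (spin φ hφ) := by
  refine (injective_iff_map_eq_zero (spin φ hφ)).2 fun M hM => ?_
  have hS : ((1 : Matrix (Fin 2) (Fin 2) ℝ) ⊗ₖ JD l ℝ) * (1 ⊗ₖ JD l ℝ) = 1 := by
    rw [← Matrix.mul_kronecker_mul, Matrix.mul_one, JD_mul_JD, Matrix.one_kronecker_one]
  have h := eq_zero_of_quad_eq_zero hφ hS (one_kronecker_transpose M.2) hM
  -- The (0, 0) block of 1 ⊗ (M · `JD`) is M · `JD` itself.
  have h' : (M : Matrix (l ⊕ l) (l ⊕ l) ℝ) * JD l ℝ = 0 := by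
    ext a b
    simpa using congrFun (congrFun h (0, a)) (0, b)
  ext1
  calc (M : Matrix (l ⊕ l) (l ⊕ l) ℝ) = M * JD l ℝ * JD l ℝ := by
        rw [Matrix.mul_assoc, JD_mul_JD, Matrix.mul_one]
    _ = 0 := by rw [h', Matrix.zero_mul]

/-- The space of the elements `quadTensor φ rot N` with `N` self-adjoint. -/
def spinCompl (φ : Fin 2 × (l ⊕ l) → A) : Submodule ℝ A := (selfAdjD l).map (quadTensor φ rot)

theorem lie_spin_spinCompl {φ : Fin 2 × (l ⊕ l) → A} (hφ) {x y : A}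
    (hx : x ∈ (spin φ hφ).range) (hy : y ∈ spinCompl φ) : ⁅x, y⁆ ∈ spinCompl φ := by
  obtain ⟨M, rfl⟩ := hx
  obtain ⟨N, hN, rfl⟩ := hy
  refine ⟨⁅(M : Matrix (l ⊕ l) (l ⊕ l) ℝ), N⁆, lie_mem_selfAdjD M.2 hN, ?_⟩
  have h := lie_quadTensor hφ (K' := rot) (by simp) (one_kronecker_transpose M.2) N
  rw [one_mul] at h
  exact h.symm

theorem lie_spinCompl_spinCompl {φ : Fin 2 × (l ⊕ l) → A} (hφ) {x y : A}
    (hx : x ∈ spinCompl φ) (hy : y ∈ spinCompl φ) : ⁅x, y⁆ ∈ (spin φ hφ).range := by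
  obtain ⟨M, hM, rfl⟩ := hx
  obtain ⟨N, hN, rfl⟩ := hy
  -- The sign comes from `rot` * `rot` = -1.
  refine ⟨-⟨⁅M, N⁆, lie_mem_typeD hM hN⟩, ?_⟩
  have h := lie_quadTensor hφ (K' := rot) rfl (rot_kronecker_transpose hM) N
  rw [rot_mul_rot, quadTensor_apply φ (-1), ← neg_one_smul ℝ (1 : Matrix (Fin 2) (Fin 2) ℝ),
    Matrix.smul_kronecker, map_smul, neg_one_smul] at h
  exact (map_neg (spin φ hφ) _).trans h.symm

theorem quadTensor_fromBlocks (φ : Fin 2 × (l ⊕ l) → A) (K : Matrix (Fin 2) (Fin 2) ℝ)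
    (B C : Matrix l l ℝ) :
    quadTensor φ K (Matrix.fromBlocks 0 B C 0) =
      (1 / 2 : ℝ) • ∑ i, ∑ i', K i i' • ∑ a, ∑ b,
        (B a b • (φ (i, .inl a) * φ (i', .inl b)) + C a b • (φ (i, .inr a) * φ (i', .inr b))) := by
  rw [quadTensor_apply, fromBlocks_mul_JD, quad_apply]
  congr 1
  simp only [Fintype.sum_prod_type, Matrix.kronecker_apply, Fintype.sum_sum_type,
    Matrix.fromBlocks_apply₁₁, Matrix.fromBlocks_apply₁₂, Matrix.fromBlocks_apply₂₁,
    Matrix.fromBlocks_apply₂₂, Matrix.zero_apply, zero_smul, smul_zero, Finset.sum_const_zero,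
    add_zero, zero_add, Fin.sum_univ_two, mul_smul, smul_add, Finset.sum_add_distrib,
    Finset.smul_sum]

end Kronecker

/-! ### Generation of the split orthogonal algebra by its off-diagonal blocks -/

section Generation

open LieAlgebra.Orthogonal (JD typeD)

variable {l : Type*} [Fintype l] [DecidableEq l]

theorem fromBlocks_mem_typeD {B C : Matrix l l ℝ} (A : Matrix l l ℝ) (hB : B.transpose = -B)
    (hC : C.transpose = -C) : Matrix.fromBlocks A B C (-A.transpose) ∈ typeD l ℝ := by
  rw [mem_typeD_iff, fromBlocks_mul_JD, Matrix.fromBlocks_transpose, hB, hC, Matrix.fromBlocks_neg]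
  simp

theorem exists_fromBlocks_of_mem_typeD {M : Matrix (l ⊕ l) (l ⊕ l) ℝ} (hM : M ∈ typeD l ℝ) :
    ∃ A B C : Matrix l l ℝ, B.transpose = -B ∧ C.transpose = -C ∧
      M = Matrix.fromBlocks A B C (-A.transpose) := by
  rw [mem_typeD_iff, ← Matrix.fromBlocks_toBlocks M, fromBlocks_mul_JD,
    Matrix.fromBlocks_transpose, Matrix.fromBlocks_neg, Matrix.fromBlocks_inj] at hM
  refine ⟨M.toBlocks₁₁, M.toBlocks₁₂, M.toBlocks₂₁, hM.1, hM.2.2.2, ?_⟩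
  rw [hM.2.2.1, neg_neg, Matrix.fromBlocks_toBlocks]

theorem single_sub_single_transpose {l : Type*} [DecidableEq l] (j k : l) :
    (Matrix.single j k (1 : ℝ) - Matrix.single k j 1).transpose =
      -(Matrix.single j k 1 - Matrix.single k j 1) := by
  simp

theorem mem_of_single_sub_single (P : Submodule ℝ (Matrix l l ℝ))
    (hP : ∀ j k, j ≠ k → Matrix.single j k 1 - Matrix.single k j 1 ∈ P) {B : Matrix l l ℝ}
    (hB : B.transpose = -B) : B ∈ P := by
  have h1 : B = (1 / 2 : ℝ) • ∑ j, ∑ k, B j k • (Matrix.single j k 1 - Matrix.single k j 1) := by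
    have h2 : ∑ j, ∑ k, B j k • Matrix.single j k (1 : ℝ) = B := by
      conv_rhs => rw [Matrix.matrix_eq_sum_single B]
      simp
    have h3 : ∑ j, ∑ k, B j k • Matrix.single k j (1 : ℝ) = B.transpose := by
      rw [Finset.sum_comm]
      conv_rhs => rw [Matrix.matrix_eq_sum_single B.transpose]
      simp
    simp only [smul_sub, Finset.sum_sub_distrib, h2, h3, hB]
    module
  rw [h1]
  refine P.smul_mem _ (P.sum_mem fun j _ => P.sum_mem fun k _ => P.smul_mem _ ?_)
  by_cases h : j = k
  · subst h; simp
  · exact hP j k h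

/-- The orthogonal algebra is generated by its two nilpotent blocks. -/
theorem typeD_le (hl : 3 ≤ Fintype.card l) (H : LieSubalgebra ℝ (Matrix (l ⊕ l) (l ⊕ l) ℝ))
    (hB : ∀ j k, j ≠ k →
      Matrix.fromBlocks 0 (Matrix.single j k 1 - Matrix.single k j 1) 0 0 ∈ H)
    (hC : ∀ j k, j ≠ k →
      Matrix.fromBlocks 0 0 (Matrix.single j k 1 - Matrix.single k j 1) 0 ∈ H) :
    typeD l ℝ ≤ H := by
  let pB : Submodule ℝ (Matrix l l ℝ) :=
    { carrier := {B | Matrix.fromBlocks 0 B 0 0 ∈ H}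
      add_mem' := fun {a b} ha hb => by simpa [Matrix.fromBlocks_add] using H.add_mem ha hb
      zero_mem' := by simp
      smul_mem' := fun t a ha => by simpa [Matrix.fromBlocks_smul] using H.smul_mem t ha }
  let pC : Submodule ℝ (Matrix l l ℝ) :=
    { carrier := {B | Matrix.fromBlocks 0 0 B 0 ∈ H}
      add_mem' := fun {a b} ha hb => by simpa [Matrix.fromBlocks_add] using H.add_mem ha hb
      zero_mem' := by simp
      smul_mem' := fun t a ha => by simpa [Matrix.fromBlocks_smul] using H.smul_mem t ha }
  let pA : Submodule ℝ (Matrix l l ℝ) :=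
    { carrier := {B | Matrix.fromBlocks B 0 0 (-B.transpose) ∈ H}
      add_mem' := fun {a b} ha hb => by
        simpa [Matrix.fromBlocks_add, add_comm] using H.add_mem ha hb
      zero_mem' := by simp
      smul_mem' := fun t a ha => by simpa [Matrix.fromBlocks_smul] using H.smul_mem t ha }
  have mB : ∀ B : Matrix l l ℝ, B.transpose = -B → B ∈ pB := fun B =>
    mem_of_single_sub_single pB hB
  have mC : ∀ B : Matrix l l ℝ, B.transpose = -B → B ∈ pC := fun B =>
    mem_of_single_sub_single pC hC
  -- The bracket of the two blocks is diagonal with entries BC and -CB, and CB = (BC)ᵀ for skew B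
  -- and C.
  have mul : ∀ B C : Matrix l l ℝ, B.transpose = -B → C.transpose = -C → B * C ∈ pA := by
    intro B C h h'
    have := H.lie_mem (mB B h) (mC C h')
    simpa [pA, Ring.lie_def, Matrix.fromBlocks_multiply, sub_eq_add_neg, Matrix.fromBlocks_neg,
      Matrix.fromBlocks_add, h, h'] using this
  have third : ∀ j k : l, ∃ m, m ≠ j ∧ m ≠ k := by
    intro j k
    have : ({j, k} : Finset l).card < Fintype.card l :=
      lt_of_le_of_lt Finset.card_le_two (by omega)
    obtain ⟨m, hm⟩ := Finset.exists_mem_notMem_of_card_lt_card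
      (s := {j, k}) (t := Finset.univ) (by simpa using this)
    exact ⟨m, by simpa [not_or] using hm⟩
  have diag : ∀ j k : l, j ≠ k → Matrix.single j j (1 : ℝ) + Matrix.single k k 1 ∈ pA := by
    intro j k h
    have := mul _ _ (single_sub_single_transpose j k) (single_sub_single_transpose k j)
    simpa [sub_mul, mul_sub, h, h.symm] using this
  -- Three indices are needed here: an off-diagonal unit is a product through a third index m, and a
  -- diagonal unit is solved for from the three pairwise sums given by `diag`.
  have mA : ∀ j k : l, Matrix.single j k (1 : ℝ) ∈ pA := by
    intro j k
    obtain ⟨m, hj, hk⟩ := third j k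
    by_cases h : j = k
    · subst h
      obtain ⟨m', hj', hm'⟩ := third j m
      have e : Matrix.single j j (1 : ℝ) = (1 / 2 : ℝ) •
          ((Matrix.single j j 1 + Matrix.single m m 1) +
            (Matrix.single j j 1 + Matrix.single m' m' 1) -
            (Matrix.single m m 1 + Matrix.single m' m' 1)) := by
        module
      rw [e]
      exact pA.smul_mem _ (pA.sub_mem (pA.add_mem (diag j m hj.symm) (diag j m' hj'.symm))
        (diag m m' hm'.symm))
    · have := mul _ _ (single_sub_single_transpose j m) (single_sub_single_transpose m k)
      simpa [sub_mul, mul_sub, h, hj, hk, hj.symm, hk.symm] using this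
  intro M hM
  obtain ⟨A, B, C, hB, hC, rfl⟩ := exists_fromBlocks_of_mem_typeD hM
  have e : Matrix.fromBlocks A B C (-A.transpose) = Matrix.fromBlocks A 0 0 (-A.transpose) +
      Matrix.fromBlocks 0 B 0 0 + Matrix.fromBlocks 0 0 C 0 := by
    simp [Matrix.fromBlocks_add]
  rw [e]
  refine H.add_mem (H.add_mem ?_ (mB B hB)) (mC C hC)
  change A ∈ pA
  rw [Matrix.matrix_eq_sum_single A]
  refine pA.sum_mem fun j _ => pA.sum_mem fun k _ => ?_
  simpa using pA.smul_mem (A j k) (mA j k)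

end Generation

/-! ### Lefschetz and volume operators as quadratic expressions -/

section Generators

open scoped Kronecker
open LieAlgebra.Orthogonal (JD typeD)

variable {l A : Type*} [Fintype l] [DecidableEq l] [Ring A] [Algebra ℝ A]

theorem sum_single_smul {M : Type*} [AddCommGroup M] [Module ℝ M] (j k : l) (f : l → l → M) :
    ∑ a, ∑ b, Matrix.single j k (1 : ℝ) a b • f a b = f j k := by
  simp [Matrix.single_apply, ite_and]

theorem swap_inl {l : Type*} [DecidableEq l] {φ : Fin 2 × (l ⊕ l) → A}
    (hφ : ∀ a b, φ a * φ b + φ b * φ a = ((1 : Matrix (Fin 2) (Fin 2) ℝ) ⊗ₖ JD l ℝ) a b • 1)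
    (i i' : Fin 2) (j k : l) :
    φ (i, .inl j) * φ (i', .inl k) = -(φ (i', .inl k) * φ (i, .inl j)) := by
  have := hφ (i, .inl j) (i', .inl k)
  rw [Matrix.kronecker_apply] at this
  exact eq_neg_of_add_eq_zero_left (by simpa [JD] using this)

theorem swap_inr {l : Type*} [DecidableEq l] {φ : Fin 2 × (l ⊕ l) → A}
    (hφ : ∀ a b, φ a * φ b + φ b * φ a = ((1 : Matrix (Fin 2) (Fin 2) ℝ) ⊗ₖ JD l ℝ) a b • 1)
    (i i' : Fin 2) (j k : l) :
    φ (i, .inr j) * φ (i', .inr k) = -(φ (i', .inr k) * φ (i, .inr j)) := by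
  have := hφ (i, .inr j) (i', .inr k)
  rw [Matrix.kronecker_apply] at this
  exact eq_neg_of_add_eq_zero_left (by simpa [JD] using this)

theorem quadTensor_one_inl {φ : Fin 2 × (l ⊕ l) → A}
    (hφ : ∀ a b, φ a * φ b + φ b * φ a = ((1 : Matrix (Fin 2) (Fin 2) ℝ) ⊗ₖ JD l ℝ) a b • 1)
    (j k : l) :
    quadTensor φ 1 (Matrix.fromBlocks 0 (Matrix.single j k 1 - Matrix.single k j 1) 0 0) =
      ∑ i, φ (i, .inl j) * φ (i, .inl k) := by
  rw [quadTensor_fromBlocks]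
  simp only [Matrix.sub_apply, sub_smul, Finset.sum_sub_distrib, Matrix.zero_apply, zero_smul,
    add_zero, sum_single_smul, Fin.sum_univ_two, swap_inl hφ _ _ k j]
  simp
  module

theorem quadTensor_one_inr {φ : Fin 2 × (l ⊕ l) → A}
    (hφ : ∀ a b, φ a * φ b + φ b * φ a = ((1 : Matrix (Fin 2) (Fin 2) ℝ) ⊗ₖ JD l ℝ) a b • 1)
    (j k : l) :
    quadTensor φ 1 (Matrix.fromBlocks 0 0 (Matrix.single j k 1 - Matrix.single k j 1) 0) =
      ∑ i, φ (i, .inr j) * φ (i, .inr k) := by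
  rw [quadTensor_fromBlocks]
  simp only [Matrix.sub_apply, sub_smul, Finset.sum_sub_distrib, Matrix.zero_apply, zero_smul,
    zero_add, sum_single_smul, Fin.sum_univ_two, swap_inr hφ _ _ k j]
  simp
  module

/-- Here both factors have the same j, so the skewness sits in the plane index: `rot`
antisymmetrises 0 and 1, while the coefficient in j is the symmetric unit at (j, j). -/
theorem mul_inl_mem_spinCompl {φ : Fin 2 × (l ⊕ l) → A}
    (hφ : ∀ a b, φ a * φ b + φ b * φ a = ((1 : Matrix (Fin 2) (Fin 2) ℝ) ⊗ₖ JD l ℝ) a b • 1)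
    (j : l) : φ (0, .inl j) * φ (1, .inl j) ∈ spinCompl φ := by
  refine ⟨Matrix.fromBlocks 0 (Matrix.single j j 1) 0 0, ?_, ?_⟩
  · change _ = _
    rw [fromBlocks_mul_JD]
    simp [Matrix.fromBlocks_transpose]
  · rw [quadTensor_fromBlocks]
    simp only [Matrix.zero_apply, zero_smul, add_zero, sum_single_smul, Fin.sum_univ_two,
      swap_inl hφ 1 0 j j]
    simp [rot]
    module

theorem mul_inr_mem_spinCompl {φ : Fin 2 × (l ⊕ l) → A}
    (hφ : ∀ a b, φ a * φ b + φ b * φ a = ((1 : Matrix (Fin 2) (Fin 2) ℝ) ⊗ₖ JD l ℝ) a b • 1)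
    (j : l) : φ (1, .inr j) * φ (0, .inr j) ∈ spinCompl φ := by
  rw [swap_inr hφ, neg_mem_iff]
  refine ⟨Matrix.fromBlocks 0 0 (Matrix.single j j 1) 0, ?_, ?_⟩
  · change _ = _
    rw [fromBlocks_mul_JD]
    simp [Matrix.fromBlocks_transpose]
  · rw [quadTensor_fromBlocks]
    simp only [Matrix.zero_apply, zero_smul, zero_add, sum_single_smul, Fin.sum_univ_two,
      swap_inr hφ 1 0 j j]
    simp [rot]
    module

theorem spin_range (hl : 3 ≤ Fintype.card l) {φ : Fin 2 × (l ⊕ l) → A}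
    (hφ : ∀ a b, φ a * φ b + φ b * φ a = ((1 : Matrix (Fin 2) (Fin 2) ℝ) ⊗ₖ JD l ℝ) a b • 1) :
    (spin φ hφ).range = LieSubalgebra.lieSpan ℝ A {D | ∃ j k, j ≠ k ∧
      (D = ∑ i, φ (i, .inl j) * φ (i, .inl k) ∨ D = ∑ i, φ (i, .inr k) * φ (i, .inr j))} := by
  have mB : ∀ j k : l,
      Matrix.fromBlocks 0 (Matrix.single j k 1 - Matrix.single k j 1) 0 0 ∈ typeD l ℝ := by
    intro j k
    simpa using fromBlocks_mem_typeD 0 (single_sub_single_transpose j k)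
      (C := 0) (by simp)
  have mC : ∀ j k : l,
      Matrix.fromBlocks 0 0 (Matrix.single j k 1 - Matrix.single k j 1) 0 ∈ typeD l ℝ := by
    intro j k
    simpa using fromBlocks_mem_typeD 0 (B := 0) (by simp) (single_sub_single_transpose j k)
  refine le_antisymm ?_ (LieSubalgebra.lieSpan_le.2 ?_)
  · set H := LieSubalgebra.lieSpan ℝ A {D | ∃ j k, j ≠ k ∧
      (D = ∑ i, φ (i, .inl j) * φ (i, .inl k) ∨ D = ∑ i, φ (i, .inr k) * φ (i, .inr j))} with hH
    -- Generation is known for matrices, so H is pulled back along `spin` and viewed as a subalgebra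
    -- of all matrices. In the second block j and k are exchanged, since adjunction reverses the
    -- factors.
    have h := typeD_le hl ((H.comap (spin φ hφ)).map (typeD l ℝ).incl)
      (fun j k hjk => ⟨⟨_, mB j k⟩, LieSubalgebra.subset_lieSpan
        ⟨j, k, hjk, Or.inl (quadTensor_one_inl hφ j k)⟩, rfl⟩)
      (fun j k hjk => ⟨⟨_, mC j k⟩, LieSubalgebra.subset_lieSpan
        ⟨k, j, hjk.symm, Or.inr (quadTensor_one_inr hφ j k)⟩, rfl⟩)
    rintro _ ⟨M, rfl⟩
    obtain ⟨N, hN, hNM⟩ := h M.2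
    have : N = M := Subtype.ext hNM
    exact this ▸ hN
  · rintro D ⟨j, k, -, rfl | rfl⟩
    · exact ⟨⟨_, mB j k⟩, quadTensor_one_inl hφ j k⟩
    · exact ⟨⟨_, mC k j⟩, quadTensor_one_inr hφ k j⟩

end Generators

/-! ### Operators on forms -/

section Forms

open scoped Kronecker
open LieAlgebra.Orthogonal (JD typeD)

variable {V : Type*} [AddCommGroup V] [Module ℝ V]

theorem wedge_mul (x y : ExteriorAlgebra ℝ V) : wedge (x * y) = wedge x * wedge y :=
  LinearMap.mulLeft_mul ℝ _ x y

theorem wedge_add (x y : ExteriorAlgebra ℝ V) : wedge (x + y) = wedge x + wedge y :=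
  LinearMap.ext fun z => add_mul x y z

theorem wedge_sum {κ : Type*} (S : Finset κ) (x : κ → ExteriorAlgebra ℝ V) :
    wedge (∑ i ∈ S, x i) = ∑ i ∈ S, wedge (x i) :=
  LinearMap.ext fun z => by simp [wedge, Finset.sum_mul]

theorem isAdjoint_wedge_ι (g : LinearMap.BilinForm ℝ V) (v : V) :
    IsAdjoint g (wedge (ExteriorAlgebra.ι ℝ v)) (contract g v) :=
  formInner_ι_mul g v

theorem IsAdjoint.mul {g : LinearMap.BilinForm ℝ V} {D D' E E' : Module.End ℝ (ExteriorAlgebra ℝ V)}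
    (hD : IsAdjoint g D D') (hE : IsAdjoint g E E') : IsAdjoint g (D * E) (E' * D') :=
  fun x y => by rw [Module.End.mul_apply, hD, hE, Module.End.mul_apply]

theorem IsAdjoint.sum {κ : Type*} {g : LinearMap.BilinForm ℝ V} (S : Finset κ)
    {D D' : κ → Module.End ℝ (ExteriorAlgebra ℝ V)} (h : ∀ i ∈ S, IsAdjoint g (D i) (D' i)) :
    IsAdjoint g (∑ i ∈ S, D i) (∑ i ∈ S, D' i) := fun x y => by
  simp only [LinearMap.sum_apply, map_sum]
  exact Finset.sum_congr rfl fun i hi => h i hi x y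

/-- In equal degree the value is a Gram determinant; if S ≠ T, an index of S outside T gives a zero
row. -/
theorem formInner_basis {I : Type*} [LinearOrder I] {g : LinearMap.BilinForm ℝ V}
    (b : Module.Basis I ℝ V) (hb : ∀ i j, g (b i) (b j) = if i = j then 1 else 0)
    (S T : Finset I) :
    formInner g (b.ExteriorAlgebra S) (b.ExteriorAlgebra T) = if S = T then 1 else 0 := by
  by_cases hc : T.card = S.card
  · rw [ExteriorAlgebra.basis_apply_ofCard b (rfl : S.card = S.card),
      ExteriorAlgebra.basis_apply_ofCard b hc, formInner_ιMulti]
    simp only [Function.comp_apply, hb, Set.powersetCard.ofFinEmbEquiv_symm_apply]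
    split_ifs with h
    · subst h
      convert Matrix.det_one (R := ℝ) (n := Fin S.card) using 2
      ext i j
      simp only [Matrix.of_apply, Matrix.one_apply, EmbeddingLike.apply_eq_iff_eq]
    · obtain ⟨i, hi, hi'⟩ : ∃ i ∈ S, i ∉ T := by
        by_contra! hST
        exact h (Finset.eq_of_subset_of_card_le hST hc.le)
      obtain ⟨k, rfl⟩ : i ∈ Set.range (S.orderEmbOfFin rfl) := by simpa using hi
      refine Matrix.det_eq_zero_of_row_eq_zero k fun j => if_neg fun hkj => hi' ?_
      have hj := Finset.orderEmbOfFin_mem T hc j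
      exact (show (S.orderEmbOfFin rfl) k = (T.orderEmbOfFin hc) j from hkj) ▸ hj
  · rw [ExteriorAlgebra.basis_apply, ExteriorAlgebra.basis_apply,
      formInner_ιMulti_of_ne _ _ _ (Ne.symm hc), if_neg]
    rintro rfl
    exact hc rfl

theorem eq_zero_of_formInner_eq_zero {I : Type*} [LinearOrder I] {g : LinearMap.BilinForm ℝ V}
    (b : Module.Basis I ℝ V) (hb : ∀ i j, g (b i) (b j) = if i = j then 1 else 0)
    {y : ExteriorAlgebra ℝ V} (hy : ∀ x, formInner g x y = 0) : y = 0 := by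
  refine b.ExteriorAlgebra.ext_elem fun S => ?_
  have h := hy (b.ExteriorAlgebra S)
  rw [← b.ExteriorAlgebra.linearCombination_repr y, Finsupp.linearCombination_apply,
    Finsupp.sum, map_sum] at h
  simpa [formInner_basis b hb] using h

/-- Nondegeneracy of the induced form makes the relation `IsAdjoint` single-valued, so the
generating sets contain no operators beyond the intended adjoints. -/
theorem IsAdjoint.unique {I : Type*} [LinearOrder I] {g : LinearMap.BilinForm ℝ V}
    (b : Module.Basis I ℝ V) (hb : ∀ i j, g (b i) (b j) = if i = j then 1 else 0)
    {D D' D'' : Module.End ℝ (ExteriorAlgebra ℝ V)} (h' : IsAdjoint g D D')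
    (h'' : IsAdjoint g D D'') : D' = D'' := by
  refine LinearMap.ext fun y => ?_
  refine sub_eq_zero.1 (eq_zero_of_formInner_eq_zero b hb fun x => ?_)
  rw [map_sub, ← h', ← h'', sub_self]

/-- Multiplications and contractions with the members of a family of covectors. -/
def formGen {l : Type*} (g : LinearMap.BilinForm ℝ V) (v : Fin 2 → l → V) :
    Fin 2 × (l ⊕ l) → Module.End ℝ (ExteriorAlgebra ℝ V)
  | (i, .inl j) => wedge (ExteriorAlgebra.ι ℝ (v i j))
  | (i, .inr j) => contract g (v i j)

theorem contract_mul_wedge (g : LinearMap.BilinForm ℝ V) (v w : V) :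
    contract g v * wedge (ExteriorAlgebra.ι ℝ w) + wedge (ExteriorAlgebra.ι ℝ w) * contract g v =
      g v w • 1 := by
  refine LinearMap.ext fun x => ?_
  have : contract g v (ExteriorAlgebra.ι ℝ w * x) =
      g v w • x - ExteriorAlgebra.ι ℝ w * contract g v x :=
    CliffordAlgebra.contractLeft_ι_mul _ _ _
  simp [wedge, this]

theorem formGen_mul_add {l : Type*} [DecidableEq l] {g : LinearMap.BilinForm ℝ V}
    {v : Fin 2 → l → V}
    (hv : ∀ i j i' j', g (v i j) (v i' j') = if i = i' ∧ j = j' then 1 else 0)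
    (a b : Fin 2 × (l ⊕ l)) :
    formGen g v a * formGen g v b + formGen g v b * formGen g v a =
      ((1 : Matrix (Fin 2) (Fin 2) ℝ) ⊗ₖ JD l ℝ) a b • 1 := by
  have hv' : ∀ i j i' j', g (v i j) (v i' j') =
      (1 : Matrix (Fin 2) (Fin 2) ℝ) i i' * (1 : Matrix l l ℝ) j j' := fun i j i' j' => by
    simp only [hv, Matrix.one_apply, ite_and, mul_ite, mul_one, mul_zero]
    split_ifs <;> rfl
  obtain ⟨i, j | j⟩ := a <;> obtain ⟨i', j' | j'⟩ := b <;>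
    simp only [Matrix.kronecker_apply, JD, formGen, Matrix.fromBlocks_apply₁₁,
      Matrix.fromBlocks_apply₁₂, Matrix.fromBlocks_apply₂₁, Matrix.fromBlocks_apply₂₂,
      Matrix.zero_apply, mul_zero, zero_smul]
  · rw [← wedge_mul, ← wedge_mul, ← wedge_add, ExteriorAlgebra.ι_add_mul_swap]
    exact LinearMap.mulLeft_zero_eq_zero ℝ _
  · rw [add_comm, contract_mul_wedge, hv', ← Matrix.transpose_apply 1 i i',
      ← Matrix.transpose_apply 1 j j', Matrix.transpose_one, Matrix.transpose_one]
  · rw [contract_mul_wedge, hv']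
  · refine LinearMap.ext fun x => ?_
    have := CliffordAlgebra.contractLeft_comm (Q := (0 : QuadraticForm ℝ V))
      (d := g (v i j)) (d' := g (v i' j')) x
    exact add_eq_zero_iff_eq_neg.2 this

end Forms

/-! ### Real points of a twisted Lie algebra of complex operators -/

section Complexify

variable {V : Type*} [AddCommGroup V] [Module ℝ V]

theorem eq_zero_of_complexify_add {b q D : Module.End ℝ (ExteriorAlgebra ℝ V)}
    (h : complexify b + Complex.I • complexify q = complexify D) : q = 0 := by
  refine LinearMap.ext fun x => ?_
  -- Evaluate at 1 ⊗ x and take the imaginary part, which is q x on the left and 0 on the right.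
  have hx := congrArg (fun E : Module.End ℂ (ℂ ⊗[ℝ] ExteriorAlgebra ℝ V) =>
    TensorProduct.lid ℝ _ (LinearMap.rTensor _ Complex.imLm (E (1 ⊗ₜ x)))) h
  have hc : ∀ D : Module.End ℝ (ExteriorAlgebra ℝ V), complexify D (1 ⊗ₜ x) = 1 ⊗ₜ D x :=
    fun D => LinearMap.baseChange_tmul D 1 x
  simpa [hc, TensorProduct.smul_tmul'] using hx

/-- The Lie algebra `R + i P` for a symmetric pair `(R, P)`. -/
def twist (R : LieSubalgebra ℝ (Module.End ℝ (ExteriorAlgebra ℝ V)))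
    (P : Submodule ℝ (Module.End ℝ (ExteriorAlgebra ℝ V)))
    (hRP : ∀ x ∈ R, ∀ y ∈ P, ⁅x, y⁆ ∈ P) (hPP : ∀ x ∈ P, ∀ y ∈ P, ⁅x, y⁆ ∈ R) :
    LieSubalgebra ℝ (Module.End ℂ (ℂ ⊗[ℝ] ExteriorAlgebra ℝ V)) where
  carrier := {E | ∃ b ∈ R, ∃ q ∈ P, complexify b + Complex.I • complexify q = E}
  add_mem' := by
    rintro _ _ ⟨b, hb, q, hq, rfl⟩ ⟨b', hb', q', hq', rfl⟩
    refine ⟨b + b', R.add_mem hb hb', q + q', P.add_mem hq hq', ?_⟩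
    rw [map_add, map_add, smul_add, add_add_add_comm]
  zero_mem' := ⟨0, R.zero_mem, 0, P.zero_mem, by simp⟩
  smul_mem' := by
    rintro t _ ⟨b, hb, q, hq, rfl⟩
    refine ⟨t • b, R.smul_mem t hb, t • q, P.smul_mem t hq, ?_⟩
    rw [map_smul, map_smul, smul_add, smul_comm t]
  lie_mem' := by
    rintro _ _ ⟨b, hb, q, hq, rfl⟩ ⟨b', hb', q', hq', rfl⟩
    refine ⟨⁅b, b'⁆ - ⁅q, q'⁆, R.sub_mem (R.lie_mem hb hb') (hPP q hq q' hq'),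
      ⁅b, q'⁆ - ⁅b', q⁆, P.sub_mem (hRP b hb q' hq') (hRP b' hb' q hq), ?_⟩
    have hI : ∀ x y : Module.End ℂ (ℂ ⊗[ℝ] ExteriorAlgebra ℝ V),
        ⁅Complex.I • x, Complex.I • y⁆ = -⁅x, y⁆ := fun x y => by
      have h : ∀ x y : Module.End ℂ (ℂ ⊗[ℝ] ExteriorAlgebra ℝ V),
          Complex.I • x * Complex.I • y = -(x * y) := fun x y => by
        rw [smul_mul_smul_comm, Complex.I_mul_I]
        exact neg_one_smul ℂ (x * y)
      rw [Ring.lie_def, Ring.lie_def, h, h]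
      abel
    have hr : ∀ x y : Module.End ℂ (ℂ ⊗[ℝ] ExteriorAlgebra ℝ V),
        ⁅x, Complex.I • y⁆ = Complex.I • ⁅x, y⁆ := fun x y => by
      simp only [Ring.lie_def, mul_smul_comm, smul_mul_assoc, smul_sub]
    have hl : ∀ x y : Module.End ℂ (ℂ ⊗[ℝ] ExteriorAlgebra ℝ V),
        ⁅Complex.I • x, y⁆ = -(Complex.I • ⁅y, x⁆) := fun x y => by
      simp only [Ring.lie_def, mul_smul_comm, smul_mul_assoc, smul_sub]
      abel
    rw [add_lie, lie_add, lie_add, hI, hr, hl, map_sub, map_sub, LieHom.map_lie, LieHom.map_lie,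
      LieHom.map_lie, LieHom.map_lie, smul_sub]
    abel

theorem mem_of_complexify_mem_twist {R : LieSubalgebra ℝ (Module.End ℝ (ExteriorAlgebra ℝ V))}
    {P : Submodule ℝ (Module.End ℝ (ExteriorAlgebra ℝ V))} {hRP} {hPP}
    {D : Module.End ℝ (ExteriorAlgebra ℝ V)} (h : complexify D ∈ twist R P hRP hPP) :
    complexify D ∈ R.map complexify := by
  obtain ⟨b, hb, q, -, h⟩ := h
  rw [eq_zero_of_complexify_add h, map_zero, smul_zero, add_zero] at h
  exact ⟨b, hb, h⟩

end Complexify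

/-! ### Pointwise `s`-Kähler manifolds of rank two -/

theorem linearIndependent_of_dual_basis {V I : Type*} [AddCommGroup V] [Module ℝ V] [DecidableEq I]
    {g : LinearMap.BilinForm ℝ V} {f : I → V}
    (hf : ∀ i j, g (f i) (f j) = if i = j then 1 else 0) : LinearIndependent ℝ f := by
  refine linearIndependent_iff'.2 fun S a h i hi => ?_
  have := congrArg (g (f i)) h
  simpa [hf, hi] using this

namespace PointwiseSKahler

section

variable {s c : ℕ} {X : Type*} [TopologicalSpace X]
  [ChartedSpace (EuclideanSpace ℝ (Fin ((s + 1) * 2 + c))) X]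
  [IsManifold (𝓡 ((s + 1) * 2 + c)) ∞ X] (K : PointwiseSKahler s 2 c X) {p : X} (F : K.Coframe p)

theorem exists_orthonormal_basis {p : X} (F : K.Coframe p) : ∃ b : Module.Basis (Fin ((s + 1) * 2 + c)) ℝ
    (Module.Dual ℝ (TangentSpace (𝓡 ((s + 1) * 2 + c)) p)),
    ∀ i j, K.cometric p (b i) (b j) = if i = j then 1 else 0 := by
  -- The coframe is reindexed because the basis of the exterior algebra requires a linear order.
  let e : (Fin 2 × Fin (s + 1)) ⊕ Fin c ≃ Fin ((s + 1) * 2 + c) :=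
    Fintype.equivFinOfCardEq (by simp [mul_comm])
  have hli := linearIndependent_of_dual_basis (fun a b => F.orthonormal a b)
  have hcard : Fintype.card ((Fin 2 × Fin (s + 1)) ⊕ Fin c) =
      Module.finrank ℝ (Module.Dual ℝ (TangentSpace (𝓡 ((s + 1) * 2 + c)) p)) := by
    rw [Subspace.dual_finrank_eq]
    change _ = Module.finrank ℝ (EuclideanSpace ℝ (Fin ((s + 1) * 2 + c)))
    simp [mul_comm]
  refine ⟨(basisOfLinearIndependentOfCardEqFinrank hli hcard).reindex e, fun i j => ?_⟩
  rw [Module.Basis.reindex_apply, Module.Basis.reindex_apply,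
    coe_basisOfLinearIndependentOfCardEqFinrank]
  refine (F.orthonormal _ _).trans ?_
  simp

theorem isAdjoint_unique {D D' D'' : Module.End ℝ (K.Forms p)}
    (h' : IsAdjoint (K.cometric p) D D') (h'' : IsAdjoint (K.cometric p) D D'') : D' = D'' := by
  obtain ⟨F⟩ := K.exists_coframe p
  obtain ⟨b, hb⟩ := K.exists_orthonormal_basis F
  exact IsAdjoint.unique b hb h' h''

/-- Multiplications and contractions with the covectors `v_{ij}` of an adapted coframe. -/
def gen : Fin 2 × (Fin (s + 1) ⊕ Fin (s + 1)) → Module.End ℝ (K.Forms p) :=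
  formGen (K.cometric p) F.v

open scoped Kronecker in
theorem gen_mul_add (a b : Fin 2 × (Fin (s + 1) ⊕ Fin (s + 1))) :
    K.gen F a * K.gen F b + K.gen F b * K.gen F a =
      ((1 : Matrix (Fin 2) (Fin 2) ℝ) ⊗ₖ LieAlgebra.Orthogonal.JD (Fin (s + 1)) ℝ) a b • 1 := by
  refine formGen_mul_add (fun i j i' j' => ?_) a b
  refine (F.orthonormal (Sum.inl (i, j)) (Sum.inl (i', j'))).trans ?_
  simp

theorem isAdjoint_gen (i : Fin 2) (j : Fin (s + 1)) :
    IsAdjoint (K.cometric p) (K.gen F (i, .inl j)) (K.gen F (i, .inr j)) :=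
  isAdjoint_wedge_ι _ _

theorem L_eq (j k : Fin (s + 1)) :
    K.L p j k = ∑ i, K.gen F (i, .inl j) * K.gen F (i, .inl k) := by
  rw [L, ofBilin_eq Finset.univ (fun i => F.v i j) (fun i => F.v i k) _ (F.form_eq j k), wedge_sum]
  exact Finset.sum_congr rfl fun i _ => wedge_mul _ _

theorem isAdjoint_L_iff (j k : Fin (s + 1)) (D : Module.End ℝ (K.Forms p)) :
    IsAdjoint (K.cometric p) (K.L p j k) D ↔
      D = ∑ i, K.gen F (i, .inr k) * K.gen F (i, .inr j) := by
  have h : IsAdjoint (K.cometric p) (K.L p j k)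
      (∑ i, K.gen F (i, .inr k) * K.gen F (i, .inr j)) := by
    rw [K.L_eq F]
    exact IsAdjoint.sum _ fun i _ => (K.isAdjoint_gen F i j).mul (K.isAdjoint_gen F i k)
  exact ⟨fun h' => K.isAdjoint_unique h' h, fun e => e ▸ h⟩

theorem V_eq (j : Fin (s + 1)) : K.V F j = K.gen F (0, .inl j) * K.gen F (1, .inl j) :=
  wedge_mul _ _

theorem isAdjoint_V_iff (j : Fin (s + 1)) (D : Module.End ℝ (K.Forms p)) :
    IsAdjoint (K.cometric p) (K.V F j) D ↔ D = K.gen F (1, .inr j) * K.gen F (0, .inr j) := by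
  have h : IsAdjoint (K.cometric p) (K.V F j) (K.gen F (1, .inr j) * K.gen F (0, .inr j)) := by
    rw [K.V_eq F]
    exact (K.isAdjoint_gen F 0 j).mul (K.isAdjoint_gen F 1 j)
  exact ⟨fun h' => K.isAdjoint_unique h' h, fun e => e ▸ h⟩

theorem lef_eq (hs : 2 ≤ s) : K.lef p = (spin (K.gen F) (K.gen_mul_add F)).range := by
  rw [spin_range (by simpa using hs), lef, lefGenerators]
  simp only [K.isAdjoint_L_iff F]
  simp only [K.L_eq F]

theorem volGenerators_subset : K.volGenerators F ⊆ spinCompl (K.gen F) := by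
  rintro D ⟨j, rfl | hD⟩
  · rw [K.V_eq F]
    exact mul_inl_mem_spinCompl (K.gen_mul_add F) j
  · rw [(K.isAdjoint_V_iff F j D).1 hD]
    exact mul_inr_mem_spinCompl (K.gen_mul_add F) j

theorem lie_lef_spinCompl (hs : 2 ≤ s) (x : Module.End ℝ (K.Forms p)) (hx : x ∈ K.lef p)
    (y : Module.End ℝ (K.Forms p)) (hy : y ∈ spinCompl (K.gen F)) :
    ⁅x, y⁆ ∈ spinCompl (K.gen F) := by
  rw [K.lef_eq F hs] at hx
  exact lie_spin_spinCompl (K.gen_mul_add F) hx hy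

theorem lie_spinCompl (hs : 2 ≤ s) (x : Module.End ℝ (K.Forms p))
    (hx : x ∈ spinCompl (K.gen F)) (y : Module.End ℝ (K.Forms p))
    (hy : y ∈ spinCompl (K.gen F)) : ⁅x, y⁆ ∈ K.lef p := by
  rw [K.lef_eq F hs]
  exact lie_spinCompl_spinCompl (K.gen_mul_add F) hx hy

theorem algS_le (hs : 2 ≤ s) : K.algS F ≤ twist (K.lef p) (spinCompl (K.gen F))
    (K.lie_lef_spinCompl F hs) (K.lie_spinCompl F hs) := by
  refine LieSubalgebra.lieSpan_le.2 (Set.union_subset ?_ ?_)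
  · rintro _ ⟨D, hD, rfl⟩
    exact ⟨D, LieSubalgebra.subset_lieSpan hD, 0, Submodule.zero_mem _, by simp⟩
  · rintro _ ⟨D, hD, rfl⟩
    exact ⟨0, LieSubalgebra.zero_mem _, D, K.volGenerators_subset F hD, by simp⟩

theorem map_lef_le_algS : (K.lef p).map complexify ≤ K.algS F :=
  LieSubalgebra.map_le_iff_le_comap.2 <| LieSubalgebra.lieSpan_le.2 fun D hD =>
    LieSubalgebra.subset_lieSpan (Or.inl ⟨D, hD, rfl⟩)

theorem lef_le_algR : K.lef p ≤ K.algR F :=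
  LieSubalgebra.lieSpan_mono Set.subset_union_left

end

end PointwiseSKahler

end SKahler

end

theorem mainTheorem7 {s c : ℕ} (hs : 2 ≤ s) {X : Type*} [TopologicalSpace X]
    [ChartedSpace (EuclideanSpace ℝ (Fin ((s + 1) * 2 + c))) X]
    [IsManifold (𝓡 ((s + 1) * 2 + c)) ∞ X]
    (K : SKahler.PointwiseSKahler s 2 c X) (p : X) (F : K.Coframe p) :
    Nonempty (K.lef p ≃ₗ⁅ℝ⁆ LieAlgebra.Orthogonal.so' (Fin (s + 1)) (Fin (s + 1)) ℝ) ∧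
      (K.lef p).map SKahler.complexify =
        (K.algR F).map SKahler.complexify ⊓ K.algS F := by
  refine ⟨⟨?_⟩, le_antisymm (le_inf ?_ (K.map_lef_le_algS F)) ?_⟩
  · rw [K.lef_eq F hs]
    have e := LieEquiv.ofInjective (SKahler.spin (K.gen F) (K.gen_mul_add F))
      (SKahler.spin_injective (K.gen_mul_add F))
    -- The split form `JD` diagonalises with s + 1 signs of each kind.
    have e' := LieAlgebra.Orthogonal.typeDEquivSo' (Fin (s + 1)) ℝ
    exact e.symm.trans e'
  · exact LieSubalgebra.map_le_iff_le_comap.2 fun D hD => ⟨D, K.lef_le_algR F hD, rfl⟩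
  · rintro _ ⟨⟨D, -, rfl⟩, hE⟩
    exact SKahler.mem_of_complexify_mem_twist (K.algS_le F hs hE)
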